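/- Let $g:\mathbb R^n\to\mathbb R$ be differentiable, $0<\varepsilon<\tfrac12$, and $\kappa=-\Phi^{-1}(\varepsilon)$ (so $\kappa>0$), where $\Phi$ is the distribution function of the standard normal distribution $N(0,1)$. Let $\tilde\mu\in\mathbb R^n$, let $\tilde\Sigma\in\mathbb R^{n\times n}$ be symmetric positive definite, let $A\in\mathbb R^{n\times m}$, $B\in\mathbb R^{n\times k}$, and $\alpha,\beta\ge 0$. Write $\mathcal S^{n}$ for the symmetric real $n\times n$ matrices, $\mathcal S^n_+$ for the positive semidefinite ones, $X\bullet Y=\operatorname{tr}(X^\top Y)$ and $\|X\|_F=\sqrt{X\bullet X}$. Define $$U_\mu=\{\tilde\mu+Az_1 : z_1\in\mathbb R^m,\ \|z_1\|_2\le\alpha\},\qquad U_\Sigma=\{\tilde\Sigma+BZ_2B^\top : Z_2\in\mathcal S^k,\ \|Z_2\|_F\le\beta\}\cap\mathcal S^n_+ .$$ Then, for every $\tilde x\in\mathbb R^n$, the robust reliability constraint $$\mathrm P_{\zeta\sim N(\mu,\Sigma)}\{g(\tilde x)+\nabla g(\tilde x)^\top\zeta\le 0\}\ \ge\ 1-\varepsilon\qquad\text{for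 all }\mu\in U_\mu,\ \Sigma\in U_\Sigma$$ (where $N(\mu,\Sigma)$ is the possibly degenerate normal distribution with mean $\mu$ and covariance matrix $\Sigma$) holds if and only if there exist $z\in\mathbb R$ and $W\in\mathcal S^n$ such that $$g(\tilde x)+\nabla g(\tilde x)^\top\tilde\mu+\alpha\|A^\top\nabla g(\tilde x)\|_2+\tilde\Sigma\bullet W+\beta\|B^\top WB\|_F+\kappa^2 z\le 0$$ and $$\begin{bmatrix}W&\nabla g(\tilde x)/2\\ \nabla g(\tilde x)^\top/2&z\end{bmatrix}\succeq 0 .$$ -/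

import Mathlib

open scoped Matrix

namespace RobustReliability

/-- The inner product `X • Y = tr (Xᵀ Y)` of two real matrices. -/
noncomputable def matInner {p q : ℕ} (X Y : Matrix (Fin p) (Fin q) ℝ) : ℝ :=
  (Xᵀ * Y).trace

/-- The Frobenius norm `‖X‖_F = √(X • X)`. -/
noncomputable def frobNorm {p q : ℕ} (X : Matrix (Fin p) (Fin q) ℝ) : ℝ :=
  Real.sqrt (matInner X X)

/-- A matrix acting on vectors, `ℝ^q → ℝ^p`, where both spaces carry the Euclidean norm. -/
noncomputable def matVec {p q : ℕ} (M : Matrix (Fin p) (Fin q) ℝ)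
    (v : EuclideanSpace ℝ (Fin q)) : EuclideanSpace ℝ (Fin p) :=
  WithLp.toLp 2 (M *ᵥ v.ofLp)

/-- The distribution function `Φ` of the standard normal distribution `N(0,1)`. -/
noncomputable def stdNormalCDF (t : ℝ) : ℝ :=
  ProbabilityTheory.cdf (ProbabilityTheory.gaussianReal 0 1) t

/-- The inverse `Φ⁻¹(p)` (quantile function) of the standard normal distribution function,
for `0 < p < 1`. -/
noncomputable def stdNormalQuantile (p : ℝ) : ℝ :=
  sInf {t : ℝ | p ≤ stdNormalCDF t}

/-- `κ = -Φ⁻¹(ε)`. -/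
noncomputable def kappa (ε : ℝ) : ℝ := -stdNormalQuantile ε

/-- The uncertainty set `{μ₀ + A z₁ : ‖z₁‖₂ ≤ α}` of the mean vector. -/
def meanSet {n m : ℕ} (μ₀ : EuclideanSpace ℝ (Fin n)) (A : Matrix (Fin n) (Fin m) ℝ) (α : ℝ) :
    Set (EuclideanSpace ℝ (Fin n)) :=
  {μ | ∃ z₁ : EuclideanSpace ℝ (Fin m), ‖z₁‖ ≤ α ∧ μ = μ₀ + matVec A z₁}

/-- The uncertainty set `{S₀ + B Z₂ Bᵀ : Z₂ symmetric, ‖Z₂‖_F ≤ β} ∩ S₊ⁿ` of the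
variance-covariance matrix. -/
def covSet {n k : ℕ} (S₀ : Matrix (Fin n) (Fin n) ℝ) (B : Matrix (Fin n) (Fin k) ℝ) (β : ℝ) :
    Set (Matrix (Fin n) (Fin n) ℝ) :=
  {S | (∃ Z₂ : Matrix (Fin k) (Fin k) ℝ, Z₂.IsSymm ∧ frobNorm Z₂ ≤ β ∧ S = S₀ + B * Z₂ * Bᵀ) ∧
    S.PosSemidef}

/-- The reliability constraint with specified moments: when `ζ ∼ N(μ, S)`, the linear
approximation `g(x) + ∇g(x)ᵀ ζ` is nonpositive with probability at least `1 - ε`. -/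
def ReliabilityConstraint {n : ℕ} (g : EuclideanSpace ℝ (Fin n) → ℝ) (ε : ℝ)
    (x μ : EuclideanSpace ℝ (Fin n)) (S : Matrix (Fin n) (Fin n) ℝ) : Prop :=
  1 - ε ≤ (ProbabilityTheory.multivariateGaussian μ S).real
    {ζ | g x + inner ℝ (gradient g x) ζ ≤ 0}

/-- The robust reliability constraint: the reliability constraint holds for all moments in the
uncertainty sets. -/
def RobustReliabilityConstraint {n : ℕ} (g : EuclideanSpace ℝ (Fin n) → ℝ) (ε : ℝ)
    (x : EuclideanSpace ℝ (Fin n)) (Uμ : Set (EuclideanSpace ℝ (Fin n)))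
    (US : Set (Matrix (Fin n) (Fin n) ℝ)) : Prop :=
  ∀ μ ∈ Uμ, ∀ S ∈ US, ReliabilityConstraint g ε x μ S

/-- The block matrix `[[W, v/2], [vᵀ/2, z]]`. -/
noncomputable def blockMat {n : ℕ} (W : Matrix (Fin n) (Fin n) ℝ)
    (v : EuclideanSpace ℝ (Fin n)) (z : ℝ) : Matrix (Fin n ⊕ Unit) (Fin n ⊕ Unit) ℝ :=
  Matrix.fromBlocks W (Matrix.of fun i _ => v i / 2)
    (Matrix.of fun _ j => v j / 2) (Matrix.of fun _ _ => z)

end RobustReliability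

/-! Write `v` for the gradient at `x`. For fixed moments `⟪v, ζ⟫` is a one-dimensional normal
variable, so the chance constraint reads `g x + ⟪v, μ⟫ + κ √(vᵀSv) ≤ 0`
(`reliabilityConstraint_iff`). Over the mean set, Cauchy–Schwarz gives the attained maximum `⟪v, μ₀⟫
+ α‖Aᵀv‖`. Sufficiency of the matrix condition is weak duality, `κ √(vᵀSv) ≤ S • W + κ² z`
(`mul_sqrt_le_matInner_add`), followed by Cauchy–Schwarz for the Frobenius product. Necessity needs
no strong duality theorem: at a covariance of variance `s = vᵀS₀v + β‖Bᵀv‖²`, the rank-one choice `W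
= t vvᵀ`, `z = 1/(4t)` with `t = κ/(2√s)` turns these bounds into equalities. -/

namespace RobustReliability

open MeasureTheory ProbabilityTheory

/-! ### Normal quantiles and the scalar form of the chance constraint. -/

section Normal

theorem strictMono_stdNormalCDF : StrictMono stdNormalCDF := by
  intro a b hab
  have h1 : gaussianReal 0 1 (Set.Ioc a b) = ENNReal.ofReal (stdNormalCDF b - stdNormalCDF a) := by
    conv_lhs => rw [← measure_cdf (gaussianReal 0 1)]
    exact StieltjesFunction.measure_Ioc _ _ _
  have h2 : gaussianReal 0 1 (Set.Ioc a b) ≠ 0 := fun h => by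
    have := gaussianReal_absolutelyContinuous' 0 (v := 1) one_ne_zero h
    simp [Real.volume_Ioc] at this
    linarith
  rw [h1, ne_eq, ENNReal.ofReal_eq_zero, not_le] at h2
  linarith

/-- The left jump at a point is the mass of that point, which is zero for a nondegenerate normal
law. -/
theorem continuous_stdNormalCDF : Continuous stdNormalCDF := by
  have := nullSingletonClass_gaussianReal (μ := 0) (v := 1) one_ne_zero
  rw [continuous_iff_continuousAt]
  intro a
  have h1 : gaussianReal 0 1 {a} = ENNReal.ofReal
      (cdf (gaussianReal 0 1) a - Function.leftLim (cdf (gaussianReal 0 1)) a) := by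
    conv_lhs => rw [← measure_cdf (gaussianReal 0 1)]
    exact StieltjesFunction.measure_singleton _ _
  rw [measure_singleton, eq_comm, ENNReal.ofReal_eq_zero] at h1
  have h2 : Function.leftLim (cdf (gaussianReal 0 1)) a = cdf (gaussianReal 0 1) a :=
    le_antisymm ((monotone_cdf _).leftLim_le le_rfl) (by linarith)
  refine continuousAt_iff_continuous_left'_right'.2 ⟨?_, ?_⟩
  · exact (Monotone.continuousWithinAt_Iio_iff_leftLim_eq (monotone_cdf _)).2 h2
  · exact ((cdf (gaussianReal 0 1)).right_continuous a).mono Set.Ioi_subset_Ici_self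

theorem stdNormalCDF_zero : stdNormalCDF 0 = 1 / 2 := by
  have := nullSingletonClass_gaussianReal (μ := 0) (v := 1) one_ne_zero
  have h1 : (gaussianReal 0 1).real (Set.Ici 0) = (gaussianReal 0 1).real (Set.Iic 0) := by
    have h := gaussianReal_map_neg (μ := 0) (v := 1)
    rw [neg_zero] at h
    conv_lhs => rw [← h, map_measureReal_apply (by fun_prop) measurableSet_Ici]
    congr 1
    ext y
    simp
  have h2 : (gaussianReal 0 1).real (Set.Ioi 0) = (gaussianReal 0 1).real (Set.Ici 0) :=
    measureReal_congr Ioi_ae_eq_Ici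
  have h3 := probReal_compl_eq_one_sub (μ := gaussianReal 0 1) (measurableSet_Iic (a := (0 : ℝ)))
  rw [Set.compl_Iic] at h3
  rw [stdNormalCDF, cdf_eq_real]
  linarith

theorem stdNormalCDF_stdNormalQuantile {p : ℝ} (h0 : 0 < p) (h1 : p < 1) :
    stdNormalCDF (stdNormalQuantile p) = p := by
  obtain ⟨a, ha⟩ := ((tendsto_cdf_atBot (gaussianReal 0 1)).eventually_lt_const h0).exists
  obtain ⟨b, hb⟩ := ((tendsto_cdf_atTop (gaussianReal 0 1)).eventually_const_lt h1).exists
  obtain ⟨q, hq⟩ := mem_range_of_exists_le_of_exists_ge continuous_stdNormalCDF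
    ⟨a, ha.le⟩ ⟨b, hb.le⟩
  have h : {t : ℝ | p ≤ stdNormalCDF t} = Set.Ici q := by
    ext t
    rw [Set.mem_ofPred_eq, ← hq, strictMono_stdNormalCDF.le_iff_le, Set.mem_Ici]
  rw [stdNormalQuantile, h, csInf_Ici, hq]

theorem kappa_pos {ε : ℝ} (hε0 : 0 < ε) (hε1 : ε < 1 / 2) : 0 < kappa ε := by
  rw [kappa, neg_pos, ← strictMono_stdNormalCDF.lt_iff_lt, stdNormalCDF_zero,
    stdNormalCDF_stdNormalQuantile hε0 (by linarith)]
  exact hε1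

/-- The upper quantile of a possibly degenerate normal distribution with standard deviation `σ`. -/
theorem one_sub_le_gaussianReal_Iic_iff {ε : ℝ} (hε0 : 0 < ε) (hε1 : ε < 1) (m b σ : ℝ)
    (hσ : 0 ≤ σ) :
    1 - ε ≤ (gaussianReal m (σ ^ 2).toNNReal).real (Set.Iic b) ↔ m + kappa ε * σ ≤ b := by
  -- For `σ = 0` the law is the Dirac mass at `m`, and `0 < ε < 1` decides both directions.
  rcases hσ.eq_or_lt with rfl | hσ
  · simp only [ne_eq, OfNat.ofNat_ne_zero, not_false_eq_true, zero_pow, Real.toNNReal_zero,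
      gaussianReal_zero_var, mul_zero, add_zero]
    rw [measureReal_def, Measure.dirac_apply' _ measurableSet_Iic]
    by_cases h : m ≤ b
    · simp [h, hε0.le]
    · simp [h, hε1]
  -- The slope `-σ` makes the probability `1 - Φ((m - b)/σ)`, so the `ε`-quantile appears without
  -- using the symmetry of `Φ`.
  have hmap : (gaussianReal 0 1).map (fun y => m + -σ * y) = gaussianReal m (σ ^ 2).toNNReal := by
    rw [← Function.comp_def (fun y => m + y) (fun y => -σ * y),
      ← Measure.map_map (by fun_prop) (by fun_prop), gaussianReal_map_const_mul,
      gaussianReal_map_const_add]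
    congr 1
    · ring
    · ext
      simp [sq_nonneg]
  have hpre : (fun y => m + -σ * y) ⁻¹' Set.Iic b = (Set.Iio ((m - b) / σ))ᶜ := by
    ext y
    simp only [Set.mem_preimage, Set.mem_Iic, Set.compl_Iio, Set.mem_Ici, div_le_iff₀ hσ]
    constructor <;> intro h <;> linarith
  have := nullSingletonClass_gaussianReal (μ := 0) (v := 1) one_ne_zero
  rw [← hmap, map_measureReal_apply (by fun_prop) measurableSet_Iic, hpre,
    probReal_compl_eq_one_sub measurableSet_Iio,
    measureReal_congr (Iio_ae_eq_Iic (a := (m - b) / σ)), ← cdf_eq_real, sub_le_sub_iff_left,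
    ← stdNormalCDF]
  conv_lhs => rw [← stdNormalCDF_stdNormalQuantile hε0 hε1]
  rw [strictMono_stdNormalCDF.le_iff_le, div_le_iff₀ hσ, kappa]
  constructor <;> intro h <;> linarith

theorem map_inner_multivariateGaussian {n : ℕ} (v μ : EuclideanSpace ℝ (Fin n))
    {S : Matrix (Fin n) (Fin n) ℝ} (hS : S.PosSemidef) :
    (multivariateGaussian μ S).map (fun ζ => inner ℝ v ζ) =
      gaussianReal (inner ℝ v μ) (v.ofLp ⬝ᵥ S *ᵥ v.ofLp).toNNReal := by
  have h := IsGaussian.map_eq_gaussianReal (μ := multivariateGaussian μ S) (innerSL ℝ v)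
  have h1 : ∫ y, innerSL ℝ v y ∂multivariateGaussian μ S = innerSL ℝ v μ := by
    rw [ContinuousLinearMap.integral_comp_comm _ IsGaussian.integrable_fun_id,
      integral_id_multivariateGaussian]
  have h2 : Var[innerSL ℝ v; multivariateGaussian μ S] = v.ofLp ⬝ᵥ S *ᵥ v.ofLp := by
    rw [← covarianceBilin_multivariateGaussian (μ := μ) hS, covarianceBilin_self]
    · rfl
    · exact IsGaussian.memLp_two_id
  rw [h1, h2] at h
  exact h

theorem reliabilityConstraint_iff {n : ℕ} (g : EuclideanSpace ℝ (Fin n) → ℝ) {ε : ℝ}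
    (hε0 : 0 < ε) (hε1 : ε < 1) (x μ : EuclideanSpace ℝ (Fin n))
    {S : Matrix (Fin n) (Fin n) ℝ} (hS : S.PosSemidef) :
    ReliabilityConstraint g ε x μ S ↔
      g x + inner ℝ (gradient g x) μ +
        kappa ε * √((gradient g x).ofLp ⬝ᵥ S *ᵥ (gradient g x).ofLp) ≤ 0 := by
  have hs : 0 ≤ (gradient g x).ofLp ⬝ᵥ S *ᵥ (gradient g x).ofLp := by
    simpa using hS.dotProduct_mulVec_nonneg (gradient g x).ofLp
  have hset : {ζ | g x + inner ℝ (gradient g x) ζ ≤ 0} =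
      (fun ζ => inner ℝ (gradient g x) ζ) ⁻¹' Set.Iic (-g x) := by
    ext ζ
    simp only [Set.mem_ofPred_eq, Set.mem_preimage, Set.mem_Iic]
    constructor <;> intro h <;> linarith
  rw [ReliabilityConstraint, hset, ← map_measureReal_apply (by fun_prop) measurableSet_Iic,
    map_inner_multivariateGaussian _ _ hS]
  conv_lhs => rw [← Real.sq_sqrt hs]
  rw [one_sub_le_gaussianReal_Iic_iff hε0 hε1 _ _ _ (Real.sqrt_nonneg _)]
  constructor <;> intro h <;> linarith

end Normal

/-! ### Frobenius product, block matrix and weak duality. -/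

section Matrices

open Matrix

theorem matInner_eq_sum {p q : ℕ} (X Y : Matrix (Fin p) (Fin q) ℝ) :
    matInner X Y = ∑ a : Fin q × Fin p, X a.2 a.1 * Y a.2 a.1 := by
  simp [matInner, trace, mul_apply, Fintype.sum_prod_type]

theorem matInner_self_nonneg {p q : ℕ} (X : Matrix (Fin p) (Fin q) ℝ) : 0 ≤ matInner X X := by
  rw [matInner_eq_sum]
  exact Finset.sum_nonneg fun _ _ => mul_self_nonneg _

theorem abs_matInner_le {p q : ℕ} (X Y : Matrix (Fin p) (Fin q) ℝ) :
    |matInner X Y| ≤ frobNorm X * frobNorm Y := by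
  rw [frobNorm, frobNorm, ← Real.sqrt_mul' _ (matInner_self_nonneg Y)]
  refine Real.abs_le_sqrt ?_
  simp only [matInner_eq_sum, ← sq]
  exact Finset.sum_mul_sq_le_sq_mul_sq _ _ _

theorem matInner_add_left {p q : ℕ} (X Y Z : Matrix (Fin p) (Fin q) ℝ) :
    matInner (X + Y) Z = matInner X Z + matInner Y Z := by
  simp [matInner, Matrix.add_mul]

theorem matInner_conj_left {n k : ℕ} (B : Matrix (Fin n) (Fin k) ℝ)
    (Z : Matrix (Fin k) (Fin k) ℝ) (W : Matrix (Fin n) (Fin n) ℝ) :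
    matInner (B * Z * Bᵀ) W = matInner Z (Bᵀ * W * B) := by
  simp only [matInner, transpose_mul, transpose_transpose]
  rw [Matrix.mul_assoc, trace_mul_comm]
  simp only [Matrix.mul_assoc]

theorem matInner_smul_vecMulVec {n : ℕ} (S : Matrix (Fin n) (Fin n) ℝ) (t : ℝ)
    (v : Fin n → ℝ) :
    matInner S (t • vecMulVec v v) = t * (v ⬝ᵥ S *ᵥ v) := by
  simp only [matInner, Matrix.mul_smul, trace_smul, smul_eq_mul, mul_vecMulVec, trace_vecMulVec,
    mulVec_transpose, dotProduct_mulVec]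

theorem frobNorm_smul_vecMulVec {k : ℕ} {t : ℝ} (ht : 0 ≤ t) (b : Fin k → ℝ) :
    frobNorm (t • vecMulVec b b) = t * (b ⬝ᵥ b) := by
  have h : matInner (t • vecMulVec b b) (t • vecMulVec b b) = (t * (b ⬝ᵥ b)) ^ 2 := by
    rw [matInner_smul_vecMulVec, smul_mulVec, vecMulVec_mulVec]
    simp
    ring
  rw [frobNorm, h, Real.sqrt_sq (mul_nonneg ht (by simpa using dotProduct_star_self_nonneg b))]

theorem transpose_mul_vecMulVec_mul {n k : ℕ} (B : Matrix (Fin n) (Fin k) ℝ) (t : ℝ)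
    (v : Fin n → ℝ) :
    Bᵀ * (t • vecMulVec v v) * B = t • vecMulVec (Bᵀ *ᵥ v) (Bᵀ *ᵥ v) := by
  rw [Matrix.mul_smul, Matrix.smul_mul, mul_vecMulVec, vecMulVec_mul, mulVec_transpose]

theorem dotProduct_conj_mulVec {n k : ℕ} (B : Matrix (Fin n) (Fin k) ℝ)
    (Z : Matrix (Fin k) (Fin k) ℝ) (v : Fin n → ℝ) :
    v ⬝ᵥ (B * Z * Bᵀ) *ᵥ v = (Bᵀ *ᵥ v) ⬝ᵥ Z *ᵥ (Bᵀ *ᵥ v) := by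
  rw [← mulVec_mulVec, ← mulVec_mulVec, dotProduct_mulVec, ← mulVec_transpose]

theorem inner_matVec {p q : ℕ} (A : Matrix (Fin p) (Fin q) ℝ) (v : EuclideanSpace ℝ (Fin p))
    (y : EuclideanSpace ℝ (Fin q)) :
    inner ℝ v (matVec A y) = inner ℝ (matVec Aᵀ v) y := by
  simp only [EuclideanSpace.inner_eq_star_dotProduct, matVec, star_trivial, mulVec_transpose]
  rw [dotProduct_comm, dotProduct_mulVec, dotProduct_comm]

theorem blockMat_quadratic_nonneg {n : ℕ} {W : Matrix (Fin n) (Fin n) ℝ}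
    {v : EuclideanSpace ℝ (Fin n)} {z : ℝ} (h : (blockMat W v z).PosSemidef)
    (r : Fin n → ℝ) (y : ℝ) :
    0 ≤ r ⬝ᵥ W *ᵥ r + y * (v.ofLp ⬝ᵥ r) + z * y ^ 2 := by
  have h1 := h.dotProduct_mulVec_nonneg (Sum.elim r fun _ => y)
  have h2 : star (Sum.elim r fun _ => y) ⬝ᵥ (blockMat W v z *ᵥ Sum.elim r fun _ => y) =
      r ⬝ᵥ W *ᵥ r + y * (v.ofLp ⬝ᵥ r) + z * y ^ 2 := by
    have e1 : (of fun (i : Fin n) (_ : Unit) => v i / 2) *ᵥ (fun _ => y) = (y / 2) • v.ofLp := by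
      ext i
      simp [mulVec, dotProduct]
      ring
    have e2 : (of fun (_ : Unit) (j : Fin n) => v j / 2) *ᵥ r =
        fun _ => (v.ofLp ⬝ᵥ r) / 2 := by
      ext i
      simp [mulVec, dotProduct, Finset.sum_div, div_mul_eq_mul_div]
    rw [star_trivial, blockMat, fromBlocks_mulVec, sumElim_dotProduct_sumElim]
    simp only [Sum.elim_comp_inl, Sum.elim_comp_inr, e1, e2, dotProduct_add, dotProduct_smul,
      smul_eq_mul, dotProduct_comm r v.ofLp]
    simp [dotProduct, mulVec]
    ring
  rwa [h2] at h1

/-- Weak duality between the semidefinite constraint and the standard deviation. -/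
theorem mul_sqrt_le_matInner_add {n : ℕ} {W S : Matrix (Fin n) (Fin n) ℝ}
    {v : EuclideanSpace ℝ (Fin n)} {z : ℝ} (h : (blockMat W v z).PosSemidef)
    (hS : S.PosSemidef) (c : ℝ) :
    c * √(v.ofLp ⬝ᵥ S *ᵥ v.ofLp) ≤ matInner S W + c ^ 2 * z := by
  obtain ⟨N, r, rfl⟩ := posSemidef_iff_eq_sum_vecMulVec.1 hS
  set S := ∑ i, vecMulVec (r i) (star (r i)) with hSdef
  have hs : v.ofLp ⬝ᵥ S *ᵥ v.ofLp = ∑ i, (v.ofLp ⬝ᵥ r i) ^ 2 := by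
    simp only [hSdef, sum_mulVec, dotProduct_sum, star_trivial, vecMulVec_mulVec, sq]
    refine Finset.sum_congr rfl fun i _ => ?_
    simp [dotProduct_comm (r i)]
  have hW : matInner S W = ∑ i, r i ⬝ᵥ W *ᵥ r i := by
    simp only [hSdef, matInner, transpose_sum, Matrix.sum_mul, trace_sum, star_trivial,
      transpose_vecMulVec, vecMulVec_mul, trace_vecMulVec]
    refine Finset.sum_congr rfl fun i _ => ?_
    rw [dotProduct_comm, dotProduct_mulVec, dotProduct_comm, dotProduct_comm]
  -- With `S = ∑ rᵢrᵢᵀ`, test the block matrix on each `(rᵢ, -l ⟨v, rᵢ⟩)` and sum.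
  have key (l : ℝ) :
      0 ≤ matInner S W - l * (v.ofLp ⬝ᵥ S *ᵥ v.ofLp) + z * l ^ 2 * (v.ofLp ⬝ᵥ S *ᵥ v.ofLp) := by
    rw [hs, hW, Finset.mul_sum, Finset.mul_sum, ← Finset.sum_sub_distrib, ← Finset.sum_add_distrib]
    refine Finset.sum_nonneg fun i _ => ?_
    have := blockMat_quadratic_nonneg h (r i) (-l * (v.ofLp ⬝ᵥ r i))
    linarith
  have hz : 0 ≤ z := by simpa using blockMat_quadratic_nonneg h 0 1
  have hs0 : 0 ≤ v.ofLp ⬝ᵥ S *ᵥ v.ofLp := by rw [hs]; positivity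
  rcases hs0.eq_or_lt with hs1 | hs1
  · have := key 0
    rw [← hs1, Real.sqrt_zero]
    nlinarith [mul_nonneg (sq_nonneg c) hz]
  · have hr := Real.sqrt_pos.2 hs1
    -- This `l` turns the last two terms of `key` into `-c σ + c² z`.
    have hk := key (c / √(v.ofLp ⬝ᵥ S *ᵥ v.ofLp))
    have hq := Real.sq_sqrt hs1.le
    set σ := √(v.ofLp ⬝ᵥ S *ᵥ v.ofLp)
    rw [← hq] at hk
    have e1 : c / σ * σ ^ 2 = c * σ := by field_simp
    have e2 : z * (c / σ) ^ 2 * σ ^ 2 = c ^ 2 * z := by field_simp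
    linarith

/-- The block matrix equals `(1/(4t)) uuᵀ` with `u = (2t v, 1)`. -/
theorem posSemidef_blockMat_rankOne {n : ℕ} (v : EuclideanSpace ℝ (Fin n)) {t : ℝ} (ht : 0 < t) :
    (blockMat (t • vecMulVec v.ofLp v.ofLp) v (1 / (4 * t))).PosSemidef := by
  have h := (posSemidef_vecMulVec_self_star
    (Sum.elim ((2 * t) • v.ofLp) fun _ : Unit => (1 : ℝ))).smul
    (show 0 ≤ 1 / (4 * t) by positivity)
  convert h using 1
  ext (i | i) (j | j) <;> simp [blockMat, vecMulVec_apply] <;> field_simp <;> ring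

end Matrices

/-! ### Extremal moments in the uncertainty sets. -/

section WorstCase

open Matrix

theorem exists_mem_meanSet_inner_eq {n m : ℕ} (μ₀ v : EuclideanSpace ℝ (Fin n))
    (A : Matrix (Fin n) (Fin m) ℝ) {α : ℝ} (hα : 0 ≤ α) :
    ∃ μ ∈ meanSet μ₀ A α, inner ℝ v μ = inner ℝ v μ₀ + α * ‖matVec Aᵀ v‖ := by
  set a := matVec Aᵀ v with ha
  -- If `a = 0`, the convention `α / 0 = 0` makes the witness `μ₀` itself.
  refine ⟨μ₀ + matVec A ((α / ‖a‖) • a), ⟨_, ?_, rfl⟩, ?_⟩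
  · rw [norm_smul, Real.norm_of_nonneg (by positivity)]
    exact mul_le_of_le_div₀ hα (norm_nonneg _) le_rfl
  · rw [inner_add_right, inner_matVec, ← ha, inner_smul_right, real_inner_self_eq_norm_sq]
    rcases eq_or_ne ‖a‖ 0 with h | h
    · simp [h]
    · field_simp

theorem inner_le_of_mem_meanSet {n m : ℕ} {μ₀ μ : EuclideanSpace ℝ (Fin n)}
    {A : Matrix (Fin n) (Fin m) ℝ} {α : ℝ} (hμ : μ ∈ meanSet μ₀ A α)
    (v : EuclideanSpace ℝ (Fin n)) :
    inner ℝ v μ ≤ inner ℝ v μ₀ + α * ‖matVec Aᵀ v‖ := by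
  obtain ⟨y, hy, rfl⟩ := hμ
  rw [inner_add_right, inner_matVec]
  have h1 := real_inner_le_norm (matVec Aᵀ v) y
  have h2 := mul_le_mul_of_nonneg_left hy (norm_nonneg (matVec Aᵀ v))
  linarith

/-- The perturbation `Z₂ = (β/‖b‖²) bbᵀ`, with `b = Bᵀv`, is itself positive semidefinite, so
intersecting with the cone does not exclude it. -/
theorem exists_mem_covSet_quadratic_eq {n k : ℕ} {S₀ : Matrix (Fin n) (Fin n) ℝ}
    (hS₀ : S₀.PosSemidef) (B : Matrix (Fin n) (Fin k) ℝ) {β : ℝ} (hβ : 0 ≤ β) (v : Fin n → ℝ) :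
    ∃ S ∈ covSet S₀ B β,
      v ⬝ᵥ S *ᵥ v = v ⬝ᵥ S₀ *ᵥ v + β * ((Bᵀ *ᵥ v) ⬝ᵥ (Bᵀ *ᵥ v)) := by
  set b := Bᵀ *ᵥ v with hb
  have hbb : 0 ≤ b ⬝ᵥ b := by simpa using dotProduct_star_self_nonneg b
  have hc : 0 ≤ β / (b ⬝ᵥ b) := by positivity
  have hZ : ((β / (b ⬝ᵥ b)) • vecMulVec b b).PosSemidef := by
    simpa using (posSemidef_vecMulVec_self_star b).smul hc
  refine ⟨S₀ + B * ((β / (b ⬝ᵥ b)) • vecMulVec b b) * Bᵀ, ⟨⟨_, ?_, ?_, rfl⟩, ?_⟩, ?_⟩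
  · exact hZ.isHermitian
  · rw [frobNorm_smul_vecMulVec hc]
    exact mul_le_of_le_div₀ hβ hbb le_rfl
  · exact hS₀.add (by simpa using hZ.mul_mul_conjTranspose_same B)
  · rw [add_mulVec, dotProduct_add, dotProduct_conj_mulVec, ← hb, smul_mulVec, vecMulVec_mulVec]
    rcases eq_or_ne (b ⬝ᵥ b) 0 with h | h
    · simp [h]
    · simp
      field_simp

theorem matInner_le_of_mem_covSet {n k : ℕ} {S₀ S : Matrix (Fin n) (Fin n) ℝ}
    {B : Matrix (Fin n) (Fin k) ℝ} {β : ℝ} (hS : S ∈ covSet S₀ B β)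
    (W : Matrix (Fin n) (Fin n) ℝ) :
    matInner S W ≤ matInner S₀ W + β * frobNorm (Bᵀ * W * B) := by
  obtain ⟨⟨Z, -, hZ, rfl⟩, -⟩ := hS
  rw [matInner_add_left, matInner_conj_left]
  have h1 := (le_abs_self _).trans (abs_matInner_le Z (Bᵀ * W * B))
  have h2 : frobNorm Z * frobNorm (Bᵀ * W * B) ≤ β * frobNorm (Bᵀ * W * B) :=
    mul_le_mul_of_nonneg_right hZ (Real.sqrt_nonneg _)
  linarith

end WorstCase

end RobustReliability

theorem mainTheorem3 {n m k : ℕ}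
    (g : EuclideanSpace ℝ (Fin n) → ℝ) (hg : Differentiable ℝ g)
    (ε : ℝ) (hε0 : 0 < ε) (hε1 : ε < 1 / 2)
    (μ₀ : EuclideanSpace ℝ (Fin n))
    (S₀ : Matrix (Fin n) (Fin n) ℝ) (hS₀ : S₀.PosDef)
    (A : Matrix (Fin n) (Fin m) ℝ) (B : Matrix (Fin n) (Fin k) ℝ)
    (α β : ℝ) (hα : 0 ≤ α) (hβ : 0 ≤ β)
    (x : EuclideanSpace ℝ (Fin n)) :
    RobustReliability.RobustReliabilityConstraint g ε x
        (RobustReliability.meanSet μ₀ A α) (RobustReliability.covSet S₀ B β) ↔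
      ∃ (z : ℝ) (W : Matrix (Fin n) (Fin n) ℝ), W.IsSymm ∧
        g x + inner ℝ (gradient g x) μ₀
            + α * ‖RobustReliability.matVec Aᵀ (gradient g x)‖
            + RobustReliability.matInner S₀ W
            + β * RobustReliability.frobNorm (Bᵀ * W * B)
            + RobustReliability.kappa ε ^ 2 * z ≤ 0 ∧
        (RobustReliability.blockMat W (gradient g x) z).PosSemidef := by
  constructor
  · intro h
    obtain ⟨μ, hμ, hμv⟩ :=
      RobustReliability.exists_mem_meanSet_inner_eq μ₀ (gradient g x) A hα
    obtain ⟨S, hS, hSv⟩ := RobustReliability.exists_mem_covSet_quadratic_eq hS₀.posSemidef B hβ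
      (gradient g x).ofLp
    have h1 := (RobustReliability.reliabilityConstraint_iff g hε0 (by linarith) x μ hS.2).1
      (h μ hμ S hS)
    have hκ := RobustReliability.kappa_pos hε0 hε1
    rw [hμv, hSv] at h1
    generalize gradient g x = v at *
    -- A zero gradient gives zero variance, where `t` below would degenerate; otherwise positive
    -- definiteness of `S₀` ensures `s > 0`.
    rcases eq_or_ne v 0 with rfl | hv
    · refine ⟨0, 0, Matrix.isSymm_zero, ?_, ?_⟩
      · simpa [RobustReliability.matInner, RobustReliability.frobNorm] using h1
      · have : RobustReliability.blockMat (0 : Matrix (Fin n) (Fin n) ℝ) 0 0 = 0 := by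
          ext (i | i) (j | j) <;> simp [RobustReliability.blockMat]
        rw [this]
        exact Matrix.PosSemidef.zero
    · have hpos : 0 < v.ofLp ⬝ᵥ S₀ *ᵥ v.ofLp := by
        simpa using hS₀.dotProduct_mulVec_pos (x := v.ofLp) (by simpa using hv)
      have hbb : 0 ≤ (Bᵀ *ᵥ v.ofLp) ⬝ᵥ (Bᵀ *ᵥ v.ofLp) := by
        simpa using dotProduct_star_self_nonneg (Bᵀ *ᵥ v.ofLp)
      set s := v.ofLp ⬝ᵥ S₀ *ᵥ v.ofLp + β * ((Bᵀ *ᵥ v.ofLp) ⬝ᵥ (Bᵀ *ᵥ v.ofLp)) with hs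
      have hs0 : 0 < s := by positivity
      have hσ := Real.sqrt_pos.2 hs0
      have hσs := Real.sq_sqrt hs0.le
      set κ := RobustReliability.kappa ε
      -- This is the minimiser of `t s + κ²/(4t)` over `t > 0`, with minimum `κ √s`.
      set t := κ / (2 * √s) with ht
      have ht0 : 0 < t := by positivity
      refine ⟨1 / (4 * t), t • Matrix.vecMulVec v.ofLp v.ofLp, ?_, ?_,
        RobustReliability.posSemidef_blockMat_rankOne v ht0⟩
      · simp [Matrix.IsSymm, Matrix.transpose_smul, Matrix.transpose_vecMulVec]
      · rw [RobustReliability.transpose_mul_vecMulVec_mul,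
          RobustReliability.frobNorm_smul_vecMulVec ht0.le,
          RobustReliability.matInner_smul_vecMulVec]
        have e1 : t * s + κ ^ 2 * (1 / (4 * t)) = κ * √s := by
          rw [← hσs, Real.sqrt_sq hσ.le, ht]
          field_simp
          ring
        have e2 : t * s = t * (v.ofLp ⬝ᵥ S₀ *ᵥ v.ofLp) +
            β * (t * ((Bᵀ *ᵥ v.ofLp) ⬝ᵥ (Bᵀ *ᵥ v.ofLp))) := by
          rw [hs]
          ring
        linarith
  · rintro ⟨z, W, -, h1, h2⟩ μ hμ S hS
    rw [RobustReliability.reliabilityConstraint_iff g hε0 (by linarith) x μ hS.2]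
    have h3 := RobustReliability.inner_le_of_mem_meanSet hμ (gradient g x)
    have h4 := RobustReliability.matInner_le_of_mem_covSet hS W
    have h5 := RobustReliability.mul_sqrt_le_matInner_add h2 hS.2 (RobustReliability.kappa ε)
    linarith
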